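/- Let $q\in(0,1)$ and $0<c<\frac{1}{1-q}$. For each $n$, let $G\sim\mathcal G(n,c/n)$ be the random graph on $n$ vertices in which each edge is present independently with probability $c/n$, and, independently of $G$ and of each other, let each vertex have type $1$ with probability $1-q$ and type $2$ with probability $q$. For a (not necessarily induced) subgraph of $G$ on $n'$ vertices, let $n'_1$ and $n'_2$ be its numbers of vertices of type $1$ and type $2$, so that $n'=n'_1+n'_2$, and let $X_{n'}$ be the number of subgraphs of $G$ on $n'$ vertices having more than $n'_1+2n'_2$ edges. Then there exists a constant $\alpha>0$, depending only on $q$ and $c$, such that $$\mathbb P\Bigl(\sum_{1\le n'\le \alpha n} X_{n'}=0\Bigr)\longrightarrow 1\qquad (n\to\infty).$$ -/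

import Mathlib

open scoped Topology

namespace TypedGraph

open MeasureTheory ProbabilityTheory

/-- The real number `x` as a probability; values outside `[0, 1]` are truncated to `0` or `1`
(for `x = c / n` with `c > 0` this only concerns the finitely many `n < c`). -/
noncomputable def toProb (x : ℝ) : unitInterval :=
  Set.projIcc (0 : ℝ) 1 zero_le_one x

/-- The law of the random graph `G(n, c/n)` with random vertex types: a pair `(G, T)` where `G` is
a graph on `n` vertices in which each edge is present independently with probability `c / n`, and,
independently of `G`, `T` is the set of vertices of type 2, each vertex being of type 2
with probability `q` and of type 1 with probability `1 - q`, independently of each other. -/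
noncomputable def law (q c : ℝ) (n : ℕ) : Measure (SimpleGraph (Fin n) × Set (Fin n)) :=
  (SimpleGraph.binomialRandom (Fin n) (toProb (c / n))).prod
    (setBernoulli (Set.univ : Set (Fin n)) (toProb q))

variable {V : Type*} {G : SimpleGraph V}

/-- The number of vertices of type 1 of a subgraph; `T` is the set of vertices of type 2. -/
noncomputable def n₁ (T : Set V) (H : G.Subgraph) : ℕ := (H.verts \ T).ncard

/-- The number of vertices of type 2 of a subgraph; `T` is the set of vertices of type 2. -/
noncomputable def n₂ (T : Set V) (H : G.Subgraph) : ℕ := (H.verts ∩ T).ncard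

/-- The number of subgraphs (not necessarily induced) of `G` on `k` vertices
with more than `n₁ + 2 n₂` edges. -/
noncomputable def X (G : SimpleGraph V) (T : Set V) (k : ℕ) : ℕ :=
  {H : G.Subgraph | H.verts.ncard = k ∧ n₁ T H + 2 * n₂ T H < H.edgeSet.ncard}.ncard

end TypedGraph

namespace TypedGraph

/-! A dense subgraph is reduced to a compact structure whose expected number is small. View its
edges as walks between branch vertices. While some branch vertex has degree at most 2, delete it,
or, if it is of type 1 and two different walks end there, merge them through it. A type 2 vertex
costs at most two walks and a type 1 vertex at most one, so the number of walks stays above the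
weight. The outcome (`IsSubdivision.exists_minDegree_three`) has `b` branch vertices and at least
`3b/2` walks, with all inner vertices of type 1.

Now take a first moment. A walk with `l` inner vertices has weight `(c/n)^(l+1) (1-q)^l`, and there
are at most `n^l` of them between given ends. Since `c(1-q) < 1`, the geometric series gives
`O(1/n)` per pair of ends. A union bound (`law_subdivisionEvent_le`) then gives at most `(A
b/n)^⌈b/2⌉`, whose sum over `1 ≤ b ≤ n/(4A)` is `O(1/n)`. -/

theorem bind_le_bind_left {α β : Type*} (f : α → Multiset β) {s t : Multiset α} (h : s ≤ t) :
    s.bind f ≤ t.bind f := by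
  obtain ⟨r, rfl⟩ := Multiset.le_iff_exists_add.1 h
  rw [Multiset.add_bind]
  exact Multiset.le_add_right _ _

/-! ### Combinatorics: reducing a dense subgraph to a subdivision of minimum degree three. -/

section Subdivision

variable {V : Type*}

/-- The edges of the walk from `a` to `b` whose list of inner vertices is the given one. -/
def walkEdges : V → List V → V → List (Sym2 V)
  | a, [], b => [s(a, b)]
  | a, x :: xs, b => s(a, x) :: walkEdges x xs b

theorem length_walkEdges (a : V) (xs : List V) (b : V) :
    (walkEdges a xs b).length = xs.length + 1 := by
  induction xs generalizing a with
  | nil => rfl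
  | cons x xs ih => simp [walkEdges, ih]

theorem walkEdges_append (a : V) (xs : List V) (v : V) (ys : List V) (b : V) :
    walkEdges a (xs ++ v :: ys) b = walkEdges a xs v ++ walkEdges v ys b := by
  induction xs generalizing a with
  | nil => rfl
  | cons x xs ih => simp [walkEdges, ih]

theorem walkEdges_reverse (a : V) (xs : List V) (b : V) :
    walkEdges b xs.reverse a = (walkEdges a xs b).reverse := by
  induction xs generalizing a with
  | nil => simp [walkEdges, Sym2.eq_swap]
  | cons x xs ih => simp [walkEdges, walkEdges_append, ih, Sym2.eq_swap]

/-- A walk given by its first vertex, the list of its inner vertices, and its last vertex. -/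
abbrev WalkData (V : Type*) := V × List V × V

/-- The multiset of edges of a walk. -/
def WalkData.edges (x : WalkData V) : Multiset (Sym2 V) := walkEdges x.1 x.2.1 x.2.2

/-- The multiset of inner vertices of a walk. -/
def WalkData.inner (x : WalkData V) : Multiset V := x.2.1

/-- The reversed walk. -/
def WalkData.rev (x : WalkData V) : WalkData V := (x.2.2, x.2.1.reverse, x.1)

theorem WalkData.edges_rev (x : WalkData V) : x.rev.edges = x.edges := by
  simp [WalkData.edges, WalkData.rev, walkEdges_reverse]

theorem WalkData.inner_rev (x : WalkData V) : x.rev.inner = x.inner := by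
  simp [WalkData.inner, WalkData.rev]

/-- A family `P` of walks in `G` with ends in `B` that share no edges and no inner vertices, and
whose inner vertices are of type 1 and lie outside `B`. -/
structure IsSubdivision (G : SimpleGraph V) (T : Set V) (B : Finset V)
    (P : Multiset (WalkData V)) : Prop where
  ends : ∀ x ∈ P, x.1 ∈ B ∧ x.2.2 ∈ B
  edges_nodup : (P.bind WalkData.edges).Nodup
  edges_mem : ∀ e ∈ P.bind WalkData.edges, e ∈ G.edgeSet
  inner_nodup : (P.bind WalkData.inner).Nodup
  inner_mem : ∀ v ∈ P.bind WalkData.inner, v ∉ T ∧ v ∉ B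

variable {G : SimpleGraph V} {T : Set V} {B B' : Finset V} {P Q : Multiset (WalkData V)}

theorem IsSubdivision.mono (h : IsSubdivision G T B P) (hQ : Q ≤ P) (hB : B' ⊆ B)
    (hends : ∀ x ∈ Q, x.1 ∈ B' ∧ x.2.2 ∈ B') : IsSubdivision G T B' Q where
  ends := hends
  edges_nodup := Multiset.nodup_of_le (bind_le_bind_left _ hQ) h.edges_nodup
  edges_mem e he :=
    h.edges_mem e (Multiset.mem_of_le (bind_le_bind_left _ hQ) he)
  inner_nodup := Multiset.nodup_of_le (bind_le_bind_left _ hQ) h.inner_nodup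
  inner_mem v hv :=
    have h1 := h.inner_mem v (Multiset.mem_of_le (bind_le_bind_left _ hQ) hv)
    ⟨h1.1, fun h2 => h1.2 (hB h2)⟩

theorem IsSubdivision.rev_cons {x : WalkData V} (h : IsSubdivision G T B (x ::ₘ P)) :
    IsSubdivision G T B (x.rev ::ₘ P) where
  ends y hy := by
    rcases Multiset.mem_cons.1 hy with rfl | hy
    · exact (h.ends x (Multiset.mem_cons_self _ _)).symm
    · exact h.ends y (Multiset.mem_cons_of_mem hy)
  edges_nodup := by simpa only [Multiset.cons_bind, WalkData.edges_rev] using h.edges_nodup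
  edges_mem := by simpa only [Multiset.cons_bind, WalkData.edges_rev] using h.edges_mem
  inner_nodup := by simpa only [Multiset.cons_bind, WalkData.inner_rev] using h.inner_nodup
  inner_mem := by simpa only [Multiset.cons_bind, WalkData.inner_rev] using h.inner_mem

/-- The edges are unchanged and `v` turns from a branch vertex into an inner one. It is new among
the inner vertices because these avoid `B`. -/
theorem IsSubdivision.merge [DecidableEq V] {a b v : V} {xs ys : List V}
    (h : IsSubdivision G T B ((a, xs, v) ::ₘ (v, ys, b) ::ₘ P)) (hv : v ∉ T) (hvB : v ∈ B)
    (ha : a ≠ v) (hb : b ≠ v) (hP : ∀ x ∈ P, x.1 ≠ v ∧ x.2.2 ≠ v) :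
    IsSubdivision G T (B.erase v) ((a, xs ++ v :: ys, b) ::ₘ P) := by
  have hE : ((a, xs ++ v :: ys, b) ::ₘ P : Multiset (WalkData V)).bind WalkData.edges =
      ((a, xs, v) ::ₘ (v, ys, b) ::ₘ P : Multiset (WalkData V)).bind WalkData.edges := by
    simp only [Multiset.cons_bind, WalkData.edges, walkEdges_append, ← Multiset.coe_add, add_assoc]
  have hI : ((a, xs ++ v :: ys, b) ::ₘ P : Multiset (WalkData V)).bind WalkData.inner =
      v ::ₘ ((a, xs, v) ::ₘ (v, ys, b) ::ₘ P : Multiset (WalkData V)).bind WalkData.inner := by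
    simp only [Multiset.cons_bind, WalkData.inner, ← Multiset.coe_add, ← Multiset.cons_coe,
      Multiset.add_cons, Multiset.cons_add, add_assoc]
  refine ⟨?_, hE ▸ h.edges_nodup, hE ▸ h.edges_mem, ?_, ?_⟩
  · intro x hx
    rcases Multiset.mem_cons.1 hx with rfl | hx
    · exact ⟨Finset.mem_erase.2 ⟨ha, (h.ends (a, xs, v) (by simp)).1⟩,
        Finset.mem_erase.2 ⟨hb, (h.ends (v, ys, b) (by simp)).2⟩⟩
    · have h1 := h.ends x (by simp [hx])
      exact ⟨Finset.mem_erase.2 ⟨(hP x hx).1, h1.1⟩, Finset.mem_erase.2 ⟨(hP x hx).2, h1.2⟩⟩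
  · rw [hI, Multiset.nodup_cons]
    exact ⟨fun h1 => (h.inner_mem v h1).2 hvB, h.inner_nodup⟩
  · rw [hI]
    intro w hw
    rcases Multiset.mem_cons.1 hw with rfl | hw
    · exact ⟨hv, Finset.notMem_erase _ _⟩
    · exact ⟨(h.inner_mem w hw).1, fun h1 => (h.inner_mem w hw).2 (Finset.mem_of_mem_erase h1)⟩

/-- The number of ends of walks of `P` at `v`. -/
def endCount [DecidableEq V] (P : Multiset (WalkData V)) (v : V) : ℕ :=
  P.countP (fun x => x.1 = v) + P.countP (fun x => x.2.2 = v)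

theorem sum_endCount [DecidableEq V] (h : ∀ x ∈ P, x.1 ∈ B ∧ x.2.2 ∈ B) :
    ∑ v ∈ B, endCount P v = 2 * P.card := by
  induction P using Multiset.induction_on with
  | empty => simp [endCount]
  | cons x P ih =>
    have h1 := h x (Multiset.mem_cons_self _ _)
    have h2 := ih fun y hy => h y (Multiset.mem_cons_of_mem hy)
    have h3 : ∀ v, endCount (x ::ₘ P) v =
        endCount P v + ((if x.1 = v then 1 else 0) + if x.2.2 = v then 1 else 0) := by
      intro v
      simp only [endCount, Multiset.countP_cons]
      ring
    simp only [h3, Finset.sum_add_distrib, h2, Finset.sum_ite_eq, h1, if_true,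
      Multiset.card_cons]
    ring

open Classical in
/-- The weight of a set of vertices: type 1 counts once and type 2 twice. -/
noncomputable def weight (T : Set V) (B : Finset V) : ℕ := ∑ v ∈ B, if v ∈ T then 2 else 1

theorem card_le_weight (T : Set V) (B : Finset V) : B.card ≤ weight T B := by
  classical
  rw [weight, Finset.card_eq_sum_ones]
  exact Finset.sum_le_sum fun v _ => by split_ifs <;> omega

theorem IsSubdivision.delete [DecidableEq V] (h : IsSubdivision G T B P) (v : V) :
    ∃ Q, IsSubdivision G T (B.erase v) Q ∧
      P.card = Q.card + P.countP (fun x => x.1 = v ∨ x.2.2 = v) := by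
  refine ⟨P.filter (fun x => ¬ (x.1 = v ∨ x.2.2 = v)),
    h.mono (Multiset.filter_le _ _) (Finset.erase_subset _ _) ?_, ?_⟩
  · intro x hx
    obtain ⟨hx, hv⟩ := Multiset.mem_filter.1 hx
    push Not at hv
    exact ⟨Finset.mem_erase.2 ⟨hv.1, (h.ends x hx).1⟩, Finset.mem_erase.2 ⟨hv.2, (h.ends x hx).2⟩⟩
  · rw [Multiset.card_eq_countP_add_countP (fun x => x.1 = v ∨ x.2.2 = v) P,
      ← Multiset.countP_eq_card_filter, add_comm]

/-- A type 1 vertex of `B` at which exactly two distinct non-closed walks end can be suppressed. -/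
theorem IsSubdivision.suppress [DecidableEq V] (h : IsSubdivision G T B P) {v : V} (hvB : v ∈ B)
    (hv : v ∉ T) (hdeg : endCount P v ≤ 2) (htouch : 1 < P.countP (fun x => x.1 = v ∨ x.2.2 = v)) :
    ∃ Q, IsSubdivision G T (B.erase v) Q ∧ P.card = Q.card + 1 := by
  obtain ⟨x, hxP, hx⟩ := Multiset.countP_pos.1 (zero_lt_one.trans htouch)
  obtain ⟨P, rfl⟩ := Multiset.exists_cons_of_mem hxP
  rw [Multiset.countP_cons_of_pos (p := fun x : WalkData V => x.1 = v ∨ x.2.2 = v) _ hx] at htouch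
  obtain ⟨y, hyP, hy⟩ := Multiset.countP_pos.1 (Nat.lt_of_succ_lt_succ htouch)
  obtain ⟨P, rfl⟩ := Multiset.exists_cons_of_mem hyP
  simp only [endCount, Multiset.countP_cons] at hdeg
  -- The walks `x` and `y` already use both ends available at `v`, so no other walk ends there and
  -- neither of the two is closed.
  have h1 : P.countP (fun x => x.1 = v) = 0 := by
    split_ifs at hdeg <;> first | omega | simp_all
  have h2 : P.countP (fun x => x.2.2 = v) = 0 := by
    split_ifs at hdeg <;> first | omega | simp_all
  have hP : ∀ z ∈ P, z.1 ≠ v ∧ z.2.2 ≠ v := fun z hz =>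
    ⟨Multiset.countP_eq_zero.1 h1 z hz, Multiset.countP_eq_zero.1 h2 z hz⟩
  have hx' : ∃ a xs, a ≠ v ∧ IsSubdivision G T B ((a, xs, v) ::ₘ y ::ₘ P) := by
    obtain ⟨a, xs, b⟩ := x
    by_cases hb : b = v
    · subst hb
      exact ⟨a, xs, fun h3 => by subst h3; split_ifs at hdeg <;> first | omega | simp_all, h⟩
    · have ha : a = v := by simpa [hb] using hx
      subst ha
      exact ⟨b, xs.reverse, hb, h.rev_cons⟩
  obtain ⟨a, xs, ha, h⟩ := hx'
  rw [Multiset.cons_swap] at h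
  have hy' : ∃ b ys, b ≠ v ∧ IsSubdivision G T B ((v, ys, b) ::ₘ (a, xs, v) ::ₘ P) := by
    obtain ⟨c, ys, b⟩ := y
    by_cases hc : c = v
    · subst hc
      exact ⟨b, ys, fun h3 => by subst h3; split_ifs at hdeg <;> first | omega | simp_all, h⟩
    · have hb : b = v := by simpa [hc] using hy
      subst hb
      exact ⟨c, ys.reverse, hc, h.rev_cons⟩
  obtain ⟨b, ys, hb, h⟩ := hy'
  rw [Multiset.cons_swap] at h
  exact ⟨_, h.merge hv hvB ha hb hP, by simp⟩

/-- Induction on `B.card`: removing a vertex of degree at most 2 loses no more walks than its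
weight. Once all degrees are at least 3, double counting of ends gives the last inequality. -/
theorem IsSubdivision.exists_minDegree_three (h : IsSubdivision G T B P)
    (hw : weight T B < P.card) :
    ∃ B' ⊆ B, ∃ Q, IsSubdivision G T B' Q ∧ B'.card < Q.card ∧ 3 * B'.card ≤ 2 * Q.card := by
  classical
  induction hn : B.card generalizing B P with
  | zero =>
    exact ⟨B, subset_rfl, P, h, (card_le_weight T B).trans_lt hw, by omega⟩
  | succ n ih =>
    by_cases hdeg : ∀ v ∈ B, 3 ≤ endCount P v
    · refine ⟨B, subset_rfl, P, h, (card_le_weight T B).trans_lt hw, ?_⟩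
      rw [← sum_endCount h.ends, mul_comm, ← smul_eq_mul]
      exact Finset.card_nsmul_le_sum _ _ _ hdeg
    push Not at hdeg
    obtain ⟨v, hvB, hv⟩ := hdeg
    have step : ∀ Q, IsSubdivision G T (B.erase v) Q →
        P.card ≤ Q.card + (if v ∈ T then 2 else 1) → ∃ B' ⊆ B, ∃ Q, IsSubdivision G T B' Q ∧
          B'.card < Q.card ∧ 3 * B'.card ≤ 2 * Q.card := by
      intro Q hQ hc
      have h1 : weight T B = (if v ∈ T then 2 else 1) + weight T (B.erase v) :=
        (Finset.add_sum_erase _ _ hvB).symm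
      obtain ⟨B', hB', R, hR⟩ := ih hQ (by omega) (by rw [Finset.card_erase_of_mem hvB]; omega)
      exact ⟨B', hB'.trans (Finset.erase_subset _ _), R, hR⟩
    obtain ⟨Q, hQ, hcard⟩ := h.delete v
    have hle : P.countP (fun x => x.1 = v ∨ x.2.2 = v) ≤ endCount P v := by
      clear * -
      induction P using Multiset.induction_on with
      | empty => simp
      | cons x P ih =>
        simp only [endCount, Multiset.countP_cons] at ih ⊢
        split_ifs <;> first | omega | simp_all
    by_cases hT : v ∈ T
    · exact step Q hQ (by rw [if_pos hT]; omega)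
    -- Walks are counted here, not ends, so a single closed walk at `v` falls under deletion.
    by_cases h1 : P.countP (fun x => x.1 = v ∨ x.2.2 = v) ≤ 1
    · exact step Q hQ (by rw [if_neg hT]; omega)
    · obtain ⟨Q, hQ, hcard⟩ := h.suppress hvB hT (by omega) (by omega)
      exact step Q hQ (by rw [if_neg hT]; omega)

/-- Every walk has an edge, so a repeated walk would repeat an edge. The union bound can thus run
over finsets of walks. -/
theorem IsSubdivision.nodup (h : IsSubdivision G T B P) : P.Nodup := by
  rw [Multiset.nodup_iff_le]
  intro x hx
  have h1 := Multiset.nodup_of_le (bind_le_bind_left _ hx) h.edges_nodup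
  simp only [Multiset.cons_bind, Multiset.zero_bind, add_zero] at h1
  have h2 := (Multiset.nodup_add.1 h1).2.2
  obtain ⟨e, he⟩ : ∃ e, e ∈ x.edges := by
    refine Multiset.card_pos_iff_exists_mem.1 ?_
    simp [WalkData.edges, length_walkEdges]
  exact Multiset.disjoint_left.1 h2 he he

/-- The edges of a subgraph form a subdivision with no inner vertices. -/
theorem exists_isSubdivision_of_subgraph [Finite V] (T : Set V) (H : G.Subgraph) :
    ∃ B P, IsSubdivision G T B P ∧ B.card = H.verts.ncard ∧ P.card = H.edgeSet.ncard ∧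
      weight T B = n₁ T H + 2 * n₂ T H := by
  classical
  cases nonempty_fintype V
  let f : Sym2 V → WalkData V := fun e => (e.out.1, [], e.out.2)
  have hf : ∀ e, (f e).edges = {e} := by
    intro e
    simp only [f, WalkData.edges, walkEdges, Multiset.coe_singleton]
    congr 1
    exact Quot.out_eq e
  have hbind : ∀ s : Multiset (Sym2 V), (s.map f).bind WalkData.edges = s := by
    intro s
    simp only [Multiset.bind_map, hf]
    exact (Multiset.bind_singleton s id).trans (Multiset.map_id s)
  refine ⟨H.verts.toFinset, H.edgeSet.toFinset.val.map f, ⟨?_, ?_, ?_, ?_, ?_⟩, ?_, ?_, ?_⟩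
  · intro x hx
    obtain ⟨e, he, rfl⟩ := Multiset.mem_map.1 hx
    have he : e ∈ H.edgeSet := by simpa using he
    simp only [f, Set.mem_toFinset]
    exact ⟨H.mem_verts_of_mem_edge he (Sym2.out_fst_mem e),
      H.mem_verts_of_mem_edge he (Sym2.out_snd_mem e)⟩
  · rw [hbind]
    exact Finset.nodup _
  · intro e he
    rw [hbind] at he
    exact H.edgeSet_subset (by simpa using he)
  · simp [Multiset.bind_map, f, WalkData.inner]
  · simp [Multiset.bind_map, f, WalkData.inner]
  · rw [Set.ncard_eq_toFinset_card']
  · rw [Set.ncard_eq_toFinset_card', Multiset.card_map, Finset.card_val]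
  · rw [weight, n₁, n₂, Set.ncard_eq_toFinset_card', Set.ncard_eq_toFinset_card',
      Finset.sum_ite, Finset.sum_const, Finset.sum_const, smul_eq_mul, smul_eq_mul, mul_one,
      mul_comm, add_comm]
    congr 2
    · ext; simp
    · congr 1; ext; simp

end Subdivision

end TypedGraph

namespace TypedGraph

/-! ### Probability: first moment bound for subdivisions. -/

section Probability

open MeasureTheory ProbabilityTheory unitInterval
open scoped ENNReal

theorem setBernoulli_superset_le {ι : Type*} (u : Set ι) (p : I) (A : Finset ι) :
    setBernoulli u p {s | ↑A ⊆ s} ≤ (toNNReal p : ℝ≥0∞) ^ A.card := by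
  have h : (fun p : ι → Prop => {i | p i}) ⁻¹' {s : Set ι | ↑A ⊆ s} =
      Set.pi A (fun _ => {True}) := by
    ext f
    simp [Set.subset_def, Set.mem_pi]
  rw [setBernoulli_apply', h, Measure.infinitePi_pi _ (fun i _ => MeasurableSet.singleton _),
    ← Finset.prod_const]
  refine Finset.prod_le_prod' fun i _ => ?_
  by_cases hi : i ∈ u <;> simp [hi]

theorem setBernoulli_disjoint_le {ι : Type*} (p : I) (A : Finset ι) :
    setBernoulli Set.univ p {s | ∀ i ∈ A, i ∉ s} ≤ (toNNReal (σ p) : ℝ≥0∞) ^ A.card := by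
  have h : (fun p : ι → Prop => {i | p i}) ⁻¹' {s : Set ι | ∀ i ∈ A, i ∉ s} =
      Set.pi A (fun _ => {False}) := by
    ext f
    simp [Set.mem_pi]
  rw [setBernoulli_apply', h, Measure.infinitePi_pi _ (fun i _ => MeasurableSet.singleton _),
    ← Finset.prod_const]
  refine Finset.prod_le_prod' fun i _ => ?_
  simp

theorem binomialRandom_edges_le {V : Type*} [Countable V] (p : I) (A : Finset (Sym2 V)) :
    SimpleGraph.binomialRandom V p {G | ↑A ⊆ G.edgeSet} ≤ (toNNReal p : ℝ≥0∞) ^ A.card := by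
  rw [SimpleGraph.binomialRandom_apply']
  refine (measure_mono ?_).trans (setBernoulli_superset_le _ p A)
  rintro _ ⟨G, hG, rfl⟩
  exact hG

theorem law_edges_types_le (q c : ℝ) (n : ℕ) (A : Finset (Sym2 (Fin n))) (J : Finset (Fin n)) :
    law q c n {ω | ↑A ⊆ ω.1.edgeSet ∧ ∀ i ∈ J, i ∉ ω.2} ≤
      (toNNReal (toProb (c / n)) : ℝ≥0∞) ^ A.card *
        (toNNReal (σ (toProb q)) : ℝ≥0∞) ^ J.card := by
  have h : {ω : SimpleGraph (Fin n) × Set (Fin n) | ↑A ⊆ ω.1.edgeSet ∧ ∀ i ∈ J, i ∉ ω.2} =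
      {G | ↑A ⊆ G.edgeSet} ×ˢ {s | ∀ i ∈ J, i ∉ s} := by
    ext ω
    simp
  rw [law, h, Measure.prod_prod]
  exact mul_le_mul' (binomialRandom_edges_le _ _) (setBernoulli_disjoint_le _ _)

instance (q c : ℝ) (n : ℕ) : IsProbabilityMeasure (law q c n) := by
  unfold law
  infer_instance

theorem coe_toNNReal_toProb {x : ℝ} (h0 : 0 ≤ x) (h1 : x ≤ 1) :
    (toNNReal (toProb x) : ℝ≥0∞) = ENNReal.ofReal x := by
  rw [ENNReal.ofReal, toProb, Set.projIcc_of_mem zero_le_one ⟨h0, h1⟩]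
  congr 1
  exact (Real.toNNReal_of_nonneg h0).symm

theorem coe_toNNReal_symm_toProb {x : ℝ} (h0 : 0 ≤ x) (h1 : x ≤ 1) :
    (toNNReal (σ (toProb x)) : ℝ≥0∞) = ENNReal.ofReal (1 - x) := by
  rw [ENNReal.ofReal, toProb, Set.projIcc_of_mem zero_le_one ⟨h0, h1⟩]
  congr 1
  exact (Real.toNNReal_of_nonneg (sub_nonneg.2 h1)).symm

/-- The probability weight of a walk when edges have probability `p` and type 1 has probability
`r`. -/
noncomputable def walkWeight {V : Type*} (p r : ℝ) (x : WalkData V) : ℝ :=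
  p ^ (x.2.1.length + 1) * r ^ x.2.1.length

theorem walkWeight_nonneg {V : Type*} {p r : ℝ} (hp : 0 ≤ p) (hr : 0 ≤ r) (x : WalkData V) :
    0 ≤ walkWeight p r x := by
  unfold walkWeight
  positivity

/-- The probability that a given family of walks forms a subdivision is at most the product of
the weights of the walks. -/
theorem law_isSubdivision_le {q c : ℝ} (hq0 : 0 ≤ q) (hq1 : q ≤ 1) (hc : 0 ≤ c) {n : ℕ}
    (hcn : c ≤ n) (B : Finset (Fin n)) (Q : Finset (WalkData (Fin n))) :
    law q c n {ω | IsSubdivision ω.1 ω.2 B Q.val} ≤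
      ENNReal.ofReal (∏ x ∈ Q, walkWeight (c / n) (1 - q) x) := by
  classical
  have hp0 : 0 ≤ c / n := by positivity
  have hp1 : c / n ≤ 1 := div_le_one_of_le₀ hcn (Nat.cast_nonneg n)
  -- The edges and inner vertices depend on `Q` alone; one outcome in the event certifies that they
  -- are distinct. Without such an outcome the event is empty.
  by_cases hne : ∃ ω : SimpleGraph (Fin n) × Set (Fin n), IsSubdivision ω.1 ω.2 B Q.val
  · obtain ⟨ω₀, h₀⟩ := hne
    let A : Finset (Sym2 (Fin n)) := ⟨_, h₀.edges_nodup⟩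
    let J : Finset (Fin n) := ⟨_, h₀.inner_nodup⟩
    have hA : A.card = ∑ x ∈ Q, (x.2.1.length + 1) := by
      simp only [A, Finset.card_mk, Multiset.card_bind, Finset.sum]
      congr 1
      exact Multiset.map_congr rfl fun x _ => by simp [WalkData.edges, length_walkEdges]
    have hJ : J.card = ∑ x ∈ Q, x.2.1.length := by
      simp only [J, Finset.card_mk, Multiset.card_bind, Finset.sum]
      congr 1
    refine (measure_mono ?_).trans ((law_edges_types_le q c n A J).trans_eq ?_)
    · intro ω hω
      exact ⟨fun e he => hω.edges_mem e he, fun i hi => (hω.inner_mem i hi).1⟩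
    · rw [coe_toNNReal_toProb hp0 hp1, coe_toNNReal_symm_toProb hq0 hq1, hA, hJ,
        ← ENNReal.ofReal_pow hp0, ← ENNReal.ofReal_pow (sub_nonneg.2 hq1),
        ← ENNReal.ofReal_mul (by positivity)]
      simp only [walkWeight, Finset.prod_mul_distrib, Finset.prod_pow_eq_pow_sum]
  · push Not at hne
    simp [hne]

open Classical in
/-- The lists over `V` of length at most `m`. -/
noncomputable def listsUpTo (V : Type*) [Fintype V] : ℕ → Finset (List V)
  | 0 => {[]}
  | m + 1 => insert [] ((Finset.univ ×ˢ listsUpTo V m).image fun x => x.1 :: x.2)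

theorem mem_listsUpTo {V : Type*} [Fintype V] {m : ℕ} {l : List V} (h : l.length ≤ m) :
    l ∈ listsUpTo V m := by
  induction m generalizing l with
  | zero => simpa [listsUpTo] using h
  | succ m ih =>
    cases l with
    | nil => simp [listsUpTo]
    | cons x l =>
      simp only [listsUpTo, Finset.mem_insert, Finset.mem_image, Finset.mem_product]
      exact Or.inr ⟨(x, l), ⟨Finset.mem_univ _, ih (by simpa using h)⟩, rfl⟩

theorem sum_listsUpTo_le {V : Type*} [Fintype V] (m : ℕ) {y : ℝ} (hy : 0 ≤ y)
    (h : Fintype.card V * y < 1) :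
    ∑ l ∈ listsUpTo V m, y ^ l.length ≤ 1 / (1 - Fintype.card V * y) := by
  classical
  have hpos : 0 < 1 - Fintype.card V * y := by linarith
  have h0 : 0 ≤ Fintype.card V * y := by positivity
  induction m with
  | zero =>
    simp only [listsUpTo, Finset.sum_singleton, List.length_nil, pow_zero]
    rw [le_div_iff₀ hpos]
    linarith
  | succ m ih =>
    rw [listsUpTo, Finset.sum_insert (by simp), Finset.sum_image (by
      intro a _ b _ hab
      simp only [List.cons.injEq] at hab
      exact Prod.ext hab.1 hab.2), Finset.sum_product]
    simp only [List.length_nil, pow_zero, List.length_cons, pow_succ, ← Finset.sum_mul,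
      Finset.sum_const, Finset.card_univ, nsmul_eq_mul]
    have h1 : (Fintype.card V * ∑ l ∈ listsUpTo V m, y ^ l.length) * y ≤
        (Fintype.card V * (1 / (1 - Fintype.card V * y))) * y := by gcongr
    refine (add_le_add_right h1 1).trans_eq ?_
    field_simp
    ring

/-- The walks on `V` with ends in `B` and at most `|V|` inner vertices. -/
noncomputable def walksOn {V : Type*} [Fintype V] (B : Finset V) : Finset (WalkData V) :=
  B ×ˢ listsUpTo V (Fintype.card V) ×ˢ B

theorem sum_walksOn_le {V : Type*} [Fintype V] (B : Finset V) {p r : ℝ} (hp : 0 ≤ p) (hr : 0 ≤ r)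
    (h : Fintype.card V * (p * r) < 1) :
    ∑ x ∈ walksOn B, walkWeight p r x ≤
      B.card ^ 2 * p * (1 / (1 - Fintype.card V * (p * r))) := by
  have h1 : ∀ x : WalkData V, walkWeight p r x = p * (p * r) ^ x.2.1.length := by
    intro x
    rw [walkWeight, mul_pow]
    ring
  simp only [h1, walksOn, Finset.sum_product, Finset.sum_const, nsmul_eq_mul, ← Finset.mul_sum]
  have h2 := sum_listsUpTo_le (V := V) (Fintype.card V) (mul_nonneg hp hr) h
  calc _ = B.card ^ 2 * p * ∑ l ∈ listsUpTo V (Fintype.card V), (p * r) ^ l.length := by ring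
    _ ≤ _ := by gcongr

theorem IsSubdivision.mem_walksOn {V : Type*} [Fintype V] {G : SimpleGraph V} {T : Set V}
    {B : Finset V} {P : Multiset (WalkData V)} (h : IsSubdivision G T B P) {x : WalkData V}
    (hx : x ∈ P) : x ∈ walksOn B := by
  refine Finset.mem_product.2 ⟨(h.ends x hx).1, Finset.mem_product.2 ⟨mem_listsUpTo ?_,
    (h.ends x hx).2⟩⟩
  have h1 : x.inner.Nodup := Multiset.nodup_of_le (Multiset.le_bind _ hx) h.inner_nodup
  exact List.Nodup.length_le_card (Multiset.coe_nodup.1 h1)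

/-- The sum is an elementary symmetric polynomial, that is, a coefficient of `∏ (1 + z f i)`, which
is at most the exponential. -/
theorem sum_powersetCard_prod_le {ι : Type*} (s : Finset ι) {f : ι → ℝ} (hf : ∀ i, 0 ≤ f i)
    (m : ℕ) {z : ℝ} (hz : 0 < z) :
    ∑ t ∈ s.powersetCard m, ∏ i ∈ t, f i ≤ (1 / z) ^ m * Real.exp (z * ∑ i ∈ s, f i) := by
  have h1 : ∑ t ∈ s.powersetCard m, ∏ i ∈ t, (z * f i) ≤ Real.exp (z * ∑ i ∈ s, f i) := by
    rw [Finset.mul_sum]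
    refine le_trans ?_ (Real.prod_one_add_le_exp_sum s fun i => mul_nonneg hz.le (hf i))
    rw [Finset.prod_one_add]
    exact Finset.sum_le_sum_of_subset_of_nonneg
      (fun t ht => Finset.mem_powerset.2 (Finset.mem_powersetCard.1 ht).1)
      fun t _ _ => Finset.prod_nonneg fun i _ => mul_nonneg hz.le (hf i)
  have h2 : ∑ t ∈ s.powersetCard m, ∏ i ∈ t, (z * f i) =
      z ^ m * ∑ t ∈ s.powersetCard m, ∏ i ∈ t, f i := by
    rw [Finset.mul_sum]
    refine Finset.sum_congr rfl fun t ht => ?_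
    rw [Finset.prod_mul_distrib, Finset.prod_const, (Finset.mem_powersetCard.1 ht).2]
  rw [h2] at h1
  rw [one_div, inv_pow, ← div_eq_inv_mul, le_div_iff₀ (by positivity), mul_comm]
  exact h1

/-- The event that some set of `b` vertices spans a subdivision with `m` walks. -/
def subdivisionEvent (n b m : ℕ) : Set (SimpleGraph (Fin n) × Set (Fin n)) :=
  {ω | ∃ B : Finset (Fin n), B.card = b ∧ ∃ Q : Finset (WalkData (Fin n)), Q.card = m ∧
    IsSubdivision ω.1 ω.2 B Q.val}

theorem law_subdivisionEvent_le {q c : ℝ} (hq0 : 0 ≤ q) (hq1 : q ≤ 1) (hc : 0 < c)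
    (hcq : c * (1 - q) < 1) {n : ℕ} (hcn : c ≤ n) (b m : ℕ) (hb : 0 < b) :
    law q c n (subdivisionEvent n b m) ≤
      ENNReal.ofReal (n.choose b * ((c * b / (n * (1 - c * (1 - q)))) ^ m * Real.exp b)) := by
  have hn : (0 : ℝ) < n := hc.trans_le hcn
  have hb' : (0 : ℝ) < b := by exact_mod_cast hb
  have hδ : 0 < 1 - c * (1 - q) := by linarith
  have hp : 0 ≤ c / n := by positivity
  have hr : 0 ≤ 1 - q := by linarith
  have hnp : (Fintype.card (Fin n) : ℝ) * (c / n * (1 - q)) = c * (1 - q) := by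
    rw [Fintype.card_fin]
    field_simp
  have hsub : subdivisionEvent n b m ⊆
      ⋃ B ∈ (Finset.univ : Finset (Fin n)).powersetCard b,
        ⋃ Q ∈ (walksOn B).powersetCard m, {ω | IsSubdivision ω.1 ω.2 B Q.val} := by
    rintro ω ⟨B, hB, Q, hQ, h⟩
    simp only [Set.mem_iUnion]
    exact ⟨B, Finset.mem_powersetCard.2 ⟨Finset.subset_univ _, hB⟩, Q,
      Finset.mem_powersetCard.2 ⟨fun x hx => h.mem_walksOn hx, hQ⟩, h⟩
  have hB : ∀ B ∈ (Finset.univ : Finset (Fin n)).powersetCard b,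
      law q c n (⋃ Q ∈ (walksOn B).powersetCard m, {ω | IsSubdivision ω.1 ω.2 B Q.val}) ≤
        ENNReal.ofReal ((c * b / (n * (1 - c * (1 - q)))) ^ m * Real.exp b) := by
    intro B hB
    refine (measure_biUnion_finset_le _ _).trans ((Finset.sum_le_sum fun Q _ =>
      law_isSubdivision_le hq0 hq1 hc.le hcn B Q).trans ?_)
    rw [← ENNReal.ofReal_sum_of_nonneg fun Q _ =>
      Finset.prod_nonneg fun x _ => walkWeight_nonneg hp hr x]
    refine ENNReal.ofReal_le_ofReal ?_
    -- This `z` makes `z` times the bound on the total walk weight equal to `b`, whence the factor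
    -- `exp b`.
    have hz : 0 < n * (1 - c * (1 - q)) / (c * b) := by positivity
    refine (sum_powersetCard_prod_le _ (walkWeight_nonneg hp hr) m hz).trans ?_
    rw [one_div_div]
    have h1 := sum_walksOn_le B hp hr (by rw [hnp]; exact hcq)
    rw [hnp, (Finset.mem_powersetCard.1 hB).2] at h1
    gcongr
    calc _ ≤ n * (1 - c * (1 - q)) / (c * b) * (b ^ 2 * (c / n) * (1 / (1 - c * (1 - q)))) := by
          gcongr
      _ = b := by field_simp
  refine (measure_mono hsub).trans ((measure_biUnion_finset_le _ _).trans
    ((Finset.sum_le_card_nsmul _ _ _ hB).trans_eq ?_))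
  rw [Finset.card_powersetCard, Finset.card_univ, Fintype.card_fin, nsmul_eq_mul,
    ENNReal.ofReal_mul (Nat.cast_nonneg _), ENNReal.ofReal_natCast]

/-- A dense subgraph forces a subdivision with few branch vertices. -/
theorem exists_mem_subdivisionEvent {n k : ℕ} {ω : SimpleGraph (Fin n) × Set (Fin n)}
    (h : X ω.1 ω.2 k ≠ 0) : ∃ b, 0 < b ∧ b ≤ k ∧ ω ∈ subdivisionEvent n b (b + (b + 1) / 2) := by
  obtain ⟨H, hHk, hH⟩ := Set.nonempty_of_ncard_ne_zero h
  obtain ⟨B, P, hP, hBc, hPc, hw⟩ := exists_isSubdivision_of_subgraph ω.2 H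
  obtain ⟨B', hB', Q, hQ, h1, h2⟩ := hP.exists_minDegree_three (by rw [hw, hPc]; exact hH)
  have hpos : 0 < B'.card := by
    obtain ⟨x, hx⟩ := Multiset.card_pos_iff_exists_mem.1 (by omega : 0 < Q.card)
    exact Finset.card_pos.2 ⟨_, (hQ.ends x hx).1⟩
  refine ⟨B'.card, hpos, ?_, B', rfl, ?_⟩
  · rw [← hHk, ← hBc]
    exact Finset.card_le_card hB'
  -- `b + (b + 1) / 2` is `3b/2` rounded up; surplus walks are discarded.
  obtain ⟨R, hR, hRc⟩ := Finset.exists_subset_card_eq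
    (s := (⟨Q, hQ.nodup⟩ : Finset (WalkData (Fin n)))) (n := B'.card + (B'.card + 1) / 2)
    (by change _ ≤ Q.card; omega)
  refine ⟨R, hRc, hQ.mono ?_ subset_rfl fun x hx => hQ.ends x (hR hx)⟩
  exact Finset.val_le_iff.2 hR

end Probability

end TypedGraph

namespace TypedGraph

/-! ### Asymptotics: summing the bound over the number of branch vertices. -/

section Asymptotics

open MeasureTheory ProbabilityTheory

theorem choose_mul_div_pow_le_exp {n : ℕ} (hn : 0 < n) (b : ℕ) :
    (n.choose b : ℝ) * ((b : ℝ) / n) ^ b ≤ Real.exp b := by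
  have hn' : (0 : ℝ) < n := by exact_mod_cast hn
  calc (n.choose b : ℝ) * ((b : ℝ) / n) ^ b ≤ (n : ℝ) ^ b / b.factorial * ((b : ℝ) / n) ^ b := by
        gcongr
        exact Nat.choose_le_pow_div b n
    _ = (b : ℝ) ^ b / b.factorial := by
        rw [div_pow]
        field_simp
    _ ≤ Real.exp b := Real.pow_div_factorial_le_exp _ (Nat.cast_nonneg b) b

/-- The factor `(b/n)^b` absorbs the binomial coefficient at the cost of `exp b`. With `h = ⌈b/2⌉`,
the bound `b ≤ 2h` yields the exponents 4 and 3. -/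
theorem choose_mul_pow_le {n b : ℕ} (hn : 0 < n) {K : ℝ} (hK : 0 ≤ K) :
    (n.choose b : ℝ) * ((K * (b / n)) ^ (b + (b + 1) / 2) * Real.exp b) ≤
      (Real.exp 4 * max K 1 ^ 3 * (b / n)) ^ ((b + 1) / 2) := by
  set h := (b + 1) / 2 with hh
  have hn' : (0 : ℝ) < n := by exact_mod_cast hn
  have hK' : K ^ (b + h) ≤ max K 1 ^ (3 * h) :=
    (pow_le_pow_left₀ hK (le_max_left _ _) _).trans
      (pow_le_pow_right₀ (le_max_right _ _) (by omega))
  have he : Real.exp b * Real.exp b ≤ Real.exp 4 ^ h := by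
    rw [← Real.exp_add, ← Real.exp_nat_mul, Real.exp_le_exp]
    have : b + b ≤ h * 4 := by omega
    exact_mod_cast this
  calc (n.choose b : ℝ) * ((K * (b / n)) ^ (b + h) * Real.exp b)
      = (n.choose b : ℝ) * ((b : ℝ) / n) ^ b * Real.exp b * K ^ (b + h) * ((b : ℝ) / n) ^ h := by
        ring
    _ ≤ Real.exp b * Real.exp b * K ^ (b + h) * ((b : ℝ) / n) ^ h := by
        gcongr
        exact choose_mul_div_pow_le_exp hn b
    _ ≤ Real.exp 4 ^ h * max K 1 ^ (3 * h) * ((b : ℝ) / n) ^ h := by gcongr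
    _ = _ := by
        rw [mul_pow, mul_pow, pow_mul]

/-- One factor `x` is kept to supply the decay `1/n`; the others give a summable geometric term. -/
theorem pow_half_le {x : ℝ} (hx0 : 0 ≤ x) (hx : x ≤ 1 / 4) {b : ℕ} (hb : 0 < b) :
    x ^ ((b + 1) / 2) ≤ 4 * x * (1 / 2) ^ b := by
  obtain ⟨h, hh⟩ : ∃ h, (b + 1) / 2 = h + 1 := ⟨(b + 1) / 2 - 1, by omega⟩
  rw [hh, pow_succ]
  have h1 : x ^ h ≤ 4 * (1 / 2 : ℝ) ^ b := by
    calc x ^ h ≤ (1 / 4 : ℝ) ^ h := pow_le_pow_left₀ hx0 hx h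
      _ = 4 * (1 / 2 : ℝ) ^ (2 * h + 2) := by
        rw [pow_add, pow_mul]
        norm_num
        ring
      _ ≤ 4 * (1 / 2 : ℝ) ^ b := by
        gcongr 4 * ?_
        exact pow_le_pow_of_le_one (by norm_num) (by norm_num) (by omega)
  calc x ^ h * x ≤ 4 * (1 / 2 : ℝ) ^ b * x := by gcongr
    _ = _ := by ring

theorem sum_mul_half_pow_le (s : Finset ℕ) : ∑ b ∈ s, (b : ℝ) * (1 / 2) ^ b ≤ 2 := by
  have h := hasSum_coe_mul_geometric_of_norm_lt_one (r := (1 / 2 : ℝ)) (by norm_num)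
  refine (sum_le_hasSum s (fun _ _ => by positivity) h).trans_eq ?_
  norm_num

theorem law_dense_compl_le {q c : ℝ} (hq0 : 0 ≤ q) (hq1 : q ≤ 1) (hc : 0 < c)
    (hcq : c * (1 - q) < 1) {A : ℝ} (hA : A = Real.exp 4 * max (c / (1 - c * (1 - q))) 1 ^ 3)
    {n : ℕ} (hcn : c ≤ n) :
    law q c n {ω | ∑ k ∈ Finset.Icc 1 ⌊1 / (4 * A) * (n : ℝ)⌋₊, X ω.1 ω.2 k = 0}ᶜ ≤
      ENNReal.ofReal (8 * A / n) := by
  have hn : (0 : ℝ) < n := hc.trans_le hcn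
  have hδ : 0 < 1 - c * (1 - q) := by linarith
  have hA0 : 0 < A := by rw [hA]; positivity
  set N := ⌊1 / (4 * A) * (n : ℝ)⌋₊ with hN
  have hsub : {ω : SimpleGraph (Fin n) × Set (Fin n) |
      ∑ k ∈ Finset.Icc 1 N, X ω.1 ω.2 k = 0}ᶜ ⊆
      ⋃ b ∈ Finset.Icc 1 N, subdivisionEvent n b (b + (b + 1) / 2) := by
    intro ω hω
    obtain ⟨k, hk, hX⟩ := Finset.exists_ne_zero_of_sum_ne_zero hω
    obtain ⟨b, hb0, hbk, hb⟩ := exists_mem_subdivisionEvent hX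
    simp only [Set.mem_iUnion]
    exact ⟨b, Finset.mem_Icc.2 ⟨hb0, hbk.trans (Finset.mem_Icc.1 hk).2⟩, hb⟩
  have hb : ∀ b ∈ Finset.Icc 1 N, law q c n (subdivisionEvent n b (b + (b + 1) / 2)) ≤
      ENNReal.ofReal (4 * A / n * (b * (1 / 2) ^ b)) := by
    intro b hb
    obtain ⟨hb0, hbN⟩ := Finset.mem_Icc.1 hb
    refine (law_subdivisionEvent_le hq0 hq1 hc hcq hcn b _ hb0).trans
      (ENNReal.ofReal_le_ofReal ?_)
    have h1 : c * b / (n * (1 - c * (1 - q))) = c / (1 - c * (1 - q)) * (b / n) := by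
      field_simp
    rw [h1]
    refine (choose_mul_pow_le (by exact_mod_cast hn) (by positivity)).trans ?_
    rw [← hA]
    have h2 : (b : ℝ) ≤ 1 / (4 * A) * n :=
      (Nat.le_floor_iff (by positivity)).1 hbN
    -- This is what fixes `α = 1 / (4 * A)`.
    have h3 : A * (b / n) ≤ 1 / 4 := by
      rw [← mul_div_assoc, div_le_iff₀ hn]
      calc A * b ≤ A * (1 / (4 * A) * n) := by gcongr
        _ = 1 / 4 * n := by field_simp
    refine (pow_half_le (by positivity) h3 hb0).trans_eq ?_
    ring
  refine (measure_mono hsub).trans ((measure_biUnion_finset_le _ _).trans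
    ((Finset.sum_le_sum hb).trans ?_))
  rw [← ENNReal.ofReal_sum_of_nonneg fun b _ => by positivity, ← Finset.mul_sum]
  refine ENNReal.ofReal_le_ofReal ?_
  calc 4 * A / n * ∑ b ∈ Finset.Icc 1 N, (b : ℝ) * (1 / 2) ^ b ≤ 4 * A / n * 2 := by
        gcongr
        exact sum_mul_half_pow_le _
    _ = 8 * A / n := by ring

end Asymptotics

end TypedGraph

theorem mainTheorem6 (q c : ℝ) (hq0 : 0 < q) (hq1 : q < 1) (hc0 : 0 < c)
    (hc : c < 1 / (1 - q)) :
    ∃ α : ℝ, 0 < α ∧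
      Filter.Tendsto
        (fun n : ℕ => TypedGraph.law q c n
          {ω | ∑ k ∈ Finset.Icc 1 ⌊α * (n : ℝ)⌋₊, TypedGraph.X ω.1 ω.2 k = 0})
        Filter.atTop (𝓝 1) := by
  have hcq : c * (1 - q) < 1 := (lt_div_iff₀ (sub_pos.2 hq1)).1 hc
  have hδ : 0 < 1 - c * (1 - q) := by linarith
  obtain ⟨A, hA⟩ : ∃ A, A = Real.exp 4 * max (c / (1 - c * (1 - q))) 1 ^ 3 := ⟨_, rfl⟩
  have hA0 : 0 < A := by rw [hA]; positivity
  refine ⟨1 / (4 * A), by positivity, ?_⟩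
  have h0 : Filter.Tendsto (fun n : ℕ => ENNReal.ofReal (8 * A / n)) Filter.atTop (𝓝 0) := by
    rw [← ENNReal.ofReal_zero]
    exact ENNReal.tendsto_ofReal (tendsto_const_div_atTop_nhds_zero_nat _)
  have h1 : Filter.Tendsto (fun n : ℕ => 1 - ENNReal.ofReal (8 * A / n)) Filter.atTop (𝓝 1) := by
    simpa using ENNReal.Tendsto.sub tendsto_const_nhds h0 (Or.inl ENNReal.one_ne_top)
  refine tendsto_of_tendsto_of_tendsto_of_le_of_le' h1 tendsto_const_nhds ?_
    (Filter.Eventually.of_forall fun n => MeasureTheory.prob_le_one)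
  -- From here on `c / n ≤ 1`, so `toProb` does not truncate.
  filter_upwards [Filter.eventually_ge_atTop ⌈c⌉₊] with n hn
  rw [tsub_le_iff_right, ← MeasureTheory.measure_univ (μ := TypedGraph.law q c n)]
  refine (MeasureTheory.measure_univ_le_add_compl _).trans (add_le_add_right
    (TypedGraph.law_dense_compl_le hq0.le hq1.le hc0 hcq hA (Nat.ceil_le.1 hn)) _)
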